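/- A $2$-coloring of the edges of the complete graph $K_n$ is a partition $E(K_n)=R\sqcup B$. A $2$-list coloring assigns to each edge $e$ of $K_n$ a nonempty list $L(e)\subseteq\{r,b\}$; its color classes are $R=\{e : r\in L(e)\}$ and $B=\{e : b\in L(e)\}$, which may overlap. In either case, a balanced copy of a graph $G$ is a copy of $G$ in $K_n$ whose edge set has a partition $E_1\sqcup E_2$ with $E_1\subseteq R$, $E_2\subseteq B$ and $\bigl||E_1|-|E_2|\bigr|\le 1$. The balancing number $\mathrm{bal}(n,G)$ is the smallest integer $m$ such that $2$-colorings of $E(K_n)$ with $|R|,|B|>m$ exist and every one of them contains a balanced copy of $G$ (it is undefined if there is no such $m$). The list balancing number $\mathrm{lbal}(n,G)$ is the smallest integer $m$ such that every $2$-list coloring of $E(K_n)$ with $|R|,|B|>m$ contains a balanced copy of $G$. **Theorem.** Let $k\ge 1$ and $n\ge \frac92k^2+\frac{13}{4}k+\frac{49}{32}$ be integers, and let $C_{4k}$ be the cycle on $4k$ vertices. Then $\mathrm{bal}(n,C_{4k})$ and $\mathrm{lbal}(n,C_{4k})$ exist and $$(k-1)n-(k-1)^2\;\le\;\mathrm{lbal}(n,C_{4k})=\mathrm{bal}(n,C_{4k})\;<\;(k-1)n+12k^2+3k.$$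 -/

import Mathlib

namespace Balancing

/-- The two colors. -/
inductive Color
  | red
  | blue

/-- The edge set of the complete graph on the vertex set `Fin n`. -/
abbrev KEdges (n : ℕ) : Set (Sym2 (Fin n)) := (⊤ : SimpleGraph (Fin n)).edgeSet

/-- A 2-coloring of the edges of the complete graph on `n` vertices. -/
abbrev TwoColoring (n : ℕ) : Type := KEdges n → Color

/-- The set of edges that have color `c`. -/
def TwoColoring.colorClass {n : ℕ} (f : TwoColoring n) (c : Color) : Set (Sym2 (Fin n)) :=
  {e | ∃ h : e ∈ KEdges n, f ⟨e, h⟩ = c}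

/-- A 2-list coloring of the edges of the complete graph on `n` vertices: every edge gets one of
the lists `{red}`, `{blue}`, `{red, blue}`, i.e. a nonempty set of colors. -/
structure TwoListColoring (n : ℕ) where
  list : KEdges n → Set Color
  list_nonempty : ∀ e, (list e).Nonempty

/-- The set of edges whose list contains the color `c`. -/
def TwoListColoring.colorClass {n : ℕ} (L : TwoListColoring n) (c : Color) :
    Set (Sym2 (Fin n)) :=
  {e | ∃ h : e ∈ KEdges n, c ∈ L.list ⟨e, h⟩}

/-- For color classes `R`, `B` (possibly overlapping) of edges of the complete graph on `n`
vertices: there is a copy of `G` whose edge set has a partition into `E₁ ⊆ R` and `E₂ ⊆ B` with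
`||E₁| - |E₂|| ≤ 1`. -/
def HasBalancedCopy {V : Type*} (G : SimpleGraph V) {n : ℕ} (R B : Set (Sym2 (Fin n))) : Prop :=
  ∃ φ : G.Copy (⊤ : SimpleGraph (Fin n)), ∃ E₁ E₂ : Set (Sym2 (Fin n)),
    E₁ ∪ E₂ = φ.toSubgraph.edgeSet ∧ Disjoint E₁ E₂ ∧ E₁ ⊆ R ∧ E₂ ⊆ B ∧
      |(E₁.ncard : ℤ) - (E₂.ncard : ℤ)| ≤ 1

/-- Both color classes of the 2-coloring `f` have more than `m` edges. -/
def TwoColoring.Exceeds {n : ℕ} (f : TwoColoring n) (m : ℤ) : Prop :=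
  m < ((f.colorClass .red).ncard : ℤ) ∧ m < ((f.colorClass .blue).ncard : ℤ)

/-- Both color classes of the 2-list coloring `L` have more than `m` edges. -/
def TwoListColoring.Exceeds {n : ℕ} (L : TwoListColoring n) (m : ℤ) : Prop :=
  m < ((L.colorClass .red).ncard : ℤ) ∧ m < ((L.colorClass .blue).ncard : ℤ)

/-- `b` is the balancing number `bal(n, G)` (so that, in particular, it exists): the smallest
integer `m` such that every 2-coloring with more than `m` edges in each color contains a balanced
copy of `G`. As usual the bound `m` must not be vacuous, i.e. 2-colorings with more than `m` edges
in each color have to exist. -/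
def IsBalancingNumber {V : Type*} (n : ℕ) (G : SimpleGraph V) (b : ℤ) : Prop :=
  IsLeast {m : ℤ | (∃ f : TwoColoring n, f.Exceeds m) ∧
    ∀ f : TwoColoring n, f.Exceeds m →
      HasBalancedCopy G (f.colorClass .red) (f.colorClass .blue)} b

/-- `b` is the list balancing number `lbal(n, G)`: the smallest integer `m` such that every 2-list
coloring with more than `m` edges in each color class contains a balanced copy of `G`. -/
def IsListBalancingNumber {V : Type*} (n : ℕ) (G : SimpleGraph V) (b : ℤ) : Prop :=
  IsLeast {m : ℤ | ∀ L : TwoListColoring n, L.Exceeds m →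
    HasBalancedCopy G (L.colorClass .red) (L.colorClass .blue)} b

end Balancing

/-!
The list balancing number agrees with the balancing number because a list coloring whose classes
both exceed a bound `m` can be thinned out to a coloring with the same property, provided that such
colorings exist at all (`exists_coloring_le_listColoring`). The lower bound comes from coloring red
exactly the edges at `k - 1` fixed vertices: a cycle then has at most `2 * (k - 1)` red edges
(`exists_coloring_not_hasBalancedCopy`).

For the upper bound, let `G` be the graph of the edges of the less frequent color. If a 4-cycle
`a v b w` has an odd number of edges in `G`, then exchanging `v` for `w` in a longer cycle through
`a v b` changes its number of edges in `G` by exactly one. The rest of the cycle is a chain from `b`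
to `a`; exchanging its interior vertices one at a time changes the count by at most two, so that on
the way from a chain rich in edges of `G` to one poor in them, one of two prescribed consecutive
counts is attained. Together this gives exactly `2 * k` edges of `G`
(`IsOddFourCycle.hasBalancedCycle`).

Rich chains consist of disjoint cherries at vertices of degree more than `4 * k`, of which the more
frequent color has plenty (`add_four_le_card_highVertices`). If `G` has fewer than `k` of them, then
many edges remain in a graph of bounded degree and provide a matching to complete the chain
(`exists_chain_of_card_edges`). This works if the odd 4-cycle contains no vertex of high degree or
leaves `k` of them untouched.

If there is no such odd 4-cycle, then `G` has a simple structure: a set of vertices without odd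
4-cycles induces a complete bipartite graph or the complement of one
(`exists_bipartition_of_not_isOddFourCycle`). Either this holds for all of `G`, or there are at most
`k + 3` vertices of high degree and no edges outside them. In both cases `k` disjoint cherries whose
centers carry all edges of `G` on the cycle make it balanced (`hasBalancedCycle_of_cover`). The case
`k = 1` is treated separately (`hasBalancedCycle_one_or_compl`).
-/

namespace Balancing

/-! ### Counting edges along lists of vertices -/

section Lists

variable {V : Type*}

open scoped Classical in
/-- The indicator, as a natural number, of adjacency in `G`. -/
noncomputable def adjInd (G : SimpleGraph V) (x y : V) : ℕ := if G.Adj x y then 1 else 0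

/-- The number of pairs of consecutive entries of a list that are adjacent in `G`. -/
noncomputable def chainCount (G : SimpleGraph V) : List V → ℕ
  | [] => 0
  | [_] => 0
  | x :: y :: l => adjInd G x y + chainCount G (y :: l)

/-- The number of edges of `G` on the closed walk that visits the entries of a list in order and
then returns to the first one. -/
noncomputable def cycleCount (G : SimpleGraph V) : List V → ℕ
  | [] => 0
  | x :: l => chainCount G (x :: l ++ [x])

variable (G : SimpleGraph V)

lemma adjInd_le_one (x y : V) : adjInd G x y ≤ 1 := by
  unfold adjInd; split_ifs <;> simp

lemma adjInd_comm (x y : V) : adjInd G x y = adjInd G y x := by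
  classical
  by_cases h : G.Adj x y
  · rw [adjInd, adjInd, if_pos h, if_pos h.symm]
  · rw [adjInd, adjInd, if_neg h, if_neg fun h' => h h'.symm]

variable {G} in
lemma adjInd_of_adj {x y : V} (h : G.Adj x y) : adjInd G x y = 1 := by
  simp [adjInd, h]

lemma adjInd_add_adjInd_compl {x y : V} (h : x ≠ y) : adjInd G x y + adjInd Gᶜ x y = 1 := by
  by_cases hxy : G.Adj x y <;> simp [adjInd, hxy, h]

@[simp] lemma chainCount_nil : chainCount G [] = 0 := rfl

@[simp] lemma chainCount_singleton (x : V) : chainCount G [x] = 0 := rfl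

@[simp] lemma chainCount_cons_cons (x y : V) (l : List V) :
    chainCount G (x :: y :: l) = adjInd G x y + chainCount G (y :: l) := rfl

lemma chainCount_le_cons (x : V) (l : List V) : chainCount G l ≤ chainCount G (x :: l) := by
  cases l <;> simp

lemma chainCount_cons_le (x : V) (l : List V) : chainCount G (x :: l) ≤ chainCount G l + 1 := by
  cases l with
  | nil => simp
  | cons y l => have := adjInd_le_one G x y; simp; omega

lemma add_chainCount_le_append (l l' : List V) :
    chainCount G l + chainCount G l' ≤ chainCount G (l ++ l') := by
  induction l with
  | nil => simp
  | cons x l ih =>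
    cases l with
    | nil => simpa using chainCount_le_cons G x l'
    | cons y l => simp at ih ⊢; omega

lemma chainCount_append_pair (l : List V) (x y : V) :
    chainCount G (l ++ [x, y]) = chainCount G (l ++ [x]) + adjInd G x y := by
  induction l with
  | nil => simp
  | cons z l ih =>
    cases l with
    | nil => simp
    | cons z' l => simp at ih ⊢; omega

/-- Replacing one entry of a list affects at most two pairs of consecutive entries. -/
lemma chainCount_replace (p q : List V) (x y : V) :
    chainCount G (p ++ x :: q) ≤ chainCount G (p ++ y :: q) + 2 := by
  induction p with
  | nil =>
    have := chainCount_cons_le G x q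
    have := chainCount_le_cons G y q
    simp; omega
  | cons c p ih =>
    cases p with
    | nil =>
      have := chainCount_cons_le G x q
      have := chainCount_le_cons G y q
      have := adjInd_le_one G c x
      simp; omega
    | cons d p => simp at ih ⊢; omega

lemma chainCount_add_compl {l : List V} (hl : l.Nodup) :
    chainCount G l + chainCount Gᶜ l = l.length - 1 := by
  induction l with
  | nil => simp
  | cons x l ih =>
    cases l with
    | nil => simp
    | cons y l =>
      have h := adjInd_add_adjInd_compl G (x := x) (y := y) (by rintro rfl; simp at hl)
      have := ih hl.of_cons
      simp at this ⊢; omega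

open scoped Classical in
lemma cycleCount_le_two_mul_countP {A : Finset V}
    (hA : ∀ x y, G.Adj x y → x ∈ A ∨ y ∈ A) (l : List V) :
    cycleCount G l ≤ 2 * l.countP (· ∈ A) := by
  have hxy : ∀ x y, adjInd G x y ≤ (if x ∈ A then 1 else 0) + (if y ∈ A then 1 else 0) := by
    intro x y
    by_cases h : G.Adj x y
    · rcases hA x y h with h' | h' <;> simp [adjInd, h, h']
    · simp [adjInd, h]
  -- on an open chain the two end entries take part in one pair only
  have key : ∀ (l : List V) (x y : V), chainCount G (x :: l ++ [y]) ≤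
      (if x ∈ A then 1 else 0) + 2 * l.countP (· ∈ A) + (if y ∈ A then 1 else 0) := by
    intro l
    induction l with
    | nil => intro x y; simpa using hxy x y
    | cons z l ih =>
      intro x y
      have h1 := ih z y
      have h2 := hxy x z
      simp only [List.cons_append, chainCount_cons_cons, List.countP_cons,
        decide_eq_true_eq] at h1 ⊢
      split_ifs at * <;> omega
  cases l with
  | nil => simp [cycleCount]
  | cons x l =>
    have := key l x x
    simp only [cycleCount, List.countP_cons, decide_eq_true_eq]
    split_ifs at * <;> omega

/-- Discrete intermediate value theorem for chains from `b` to `a`: exchanging the interior entries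
one at a time changes the count by at most two, so that two prescribed consecutive values cannot
both be skipped. -/
lemma exists_interior_of_disjoint (a b : V) (Q : Finset V) (t : ℕ) (q q' : List V) :
    ∀ p : List V, q.length = q'.length → (p ++ q ++ q').Nodup → (∀ x ∈ p ++ q ++ q', x ∉ Q) →
    chainCount G (b :: (p ++ q) ++ [a]) ≤ t + 1 → t ≤ chainCount G (b :: (p ++ q') ++ [a]) →
    ∃ l : List V, l.length = p.length + q.length ∧ l.Nodup ∧ (∀ x ∈ l, x ∉ Q) ∧
      (chainCount G (b :: l ++ [a]) = t ∨ chainCount G (b :: l ++ [a]) = t + 1) := by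
  induction q generalizing q' with
  | nil =>
    intro p hlen hnd hQ h1 h2
    obtain rfl : q' = [] := List.length_eq_zero_iff.1 hlen.symm
    refine ⟨p, by simp, by simpa using hnd, by simpa using hQ, ?_⟩
    simp only [List.append_nil] at h1 h2
    omega
  | cons x q ih =>
    intro p hlen hnd hQ h1 h2
    cases q' with
    | nil => simp at hlen
    | cons y q' =>
      by_cases h : t ≤ chainCount G (b :: (p ++ x :: q) ++ [a])
      · exact ⟨p ++ x :: q, by simp, hnd.of_append_left,
          fun z hz => hQ z (List.mem_append_left _ hz), by omega⟩
      have h3 : chainCount G (b :: (p ++ y :: q) ++ [a]) ≤ t + 1 := by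
        have := chainCount_replace G (b :: p) (q ++ [a]) y x
        simp only [List.cons_append, List.append_assoc] at this h ⊢
        omega
      obtain ⟨l, hl1, hl2, hl3, hl4⟩ := ih q' (p ++ [y]) (by simpa using hlen)
        (by
          classical
          have hp : (p ++ x :: q ++ y :: q').Perm (x :: (p ++ [y] ++ q ++ q')) := by
            rw [List.perm_iff_count]; intro z; simp [List.count_cons]; omega
          exact (hp.nodup_iff.1 hnd).of_cons)
        (by intro z hz; apply hQ; simp at hz ⊢; tauto)
        (by simpa using h3) (by simpa using h2)
      exact ⟨l, by rw [hl1]; simp; omega, hl2, hl3, hl4⟩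

variable [Fintype V]

lemma exists_nodup_avoiding (F : Finset V) (m : ℕ) (h : F.card + m ≤ Fintype.card V) :
    ∃ l : List V, l.length = m ∧ l.Nodup ∧ ∀ x ∈ l, x ∉ F := by
  classical
  obtain ⟨T, hT, hc⟩ := Finset.exists_subset_card_eq (s := Fᶜ) (n := m)
    (by rw [Finset.card_compl]; omega)
  exact ⟨T.toList, by simpa using hc, T.nodup_toList, fun x hx => by
    simpa using hT (Finset.mem_toList.1 hx)⟩

lemma exists_nodup_extension (F : Finset V) (m : ℕ) (h : F.card + m ≤ Fintype.card V)
    {l : List V} (hl : l.Nodup) (hm : l.length ≤ m) :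
    ∃ l' : List V, (l ++ l').length = m ∧ (l ++ l').Nodup ∧ ∀ x ∈ l', x ∉ F := by
  classical
  obtain ⟨l', h1, h2, h3⟩ := exists_nodup_avoiding (F ∪ l.toFinset) (m - l.length) (by
    have := Finset.card_union_le F l.toFinset
    have := List.toFinset_card_le l
    omega)
  simp only [Finset.mem_union, List.mem_toFinset, not_or] at h3
  refine ⟨l', by simp; omega, List.nodup_append.2 ⟨hl, h2, ?_⟩, fun x hx => (h3 x hx).1⟩
  rintro x hx y hy rfl
  exact (h3 x hy).2 hx

lemma exists_interior (a b : V) (Q : Finset V) (t m : ℕ)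
    (hV : Q.card + 3 * m ≤ Fintype.card V) {l l' : List V}
    (hl : l.Nodup) (hlQ : ∀ x ∈ l, x ∉ Q) (hlm : l.length = m)
    (hl' : l'.Nodup) (hlQ' : ∀ x ∈ l', x ∉ Q) (hlm' : l'.length = m)
    (h1 : chainCount G (b :: l ++ [a]) ≤ t + 1) (h2 : t ≤ chainCount G (b :: l' ++ [a])) :
    ∃ l : List V, l.length = m ∧ l.Nodup ∧ (∀ x ∈ l, x ∉ Q) ∧
      (chainCount G (b :: l ++ [a]) = t ∨ chainCount G (b :: l ++ [a]) = t + 1) := by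
  classical
  -- an intermediate chain whose interior is disjoint from both given interiors
  obtain ⟨c, hc1, hc2, hc3⟩ := exists_nodup_avoiding (Q ∪ l.toFinset ∪ l'.toFinset) m (by
    have := Finset.card_union_le (Q ∪ l.toFinset) l'.toFinset
    have := Finset.card_union_le Q l.toFinset
    have := List.toFinset_card_le l
    have := List.toFinset_card_le l'
    omega)
  simp only [Finset.mem_union, List.mem_toFinset, not_or] at hc3
  rcases le_total t (chainCount G (b :: c ++ [a])) with h | h
  · have := exists_interior_of_disjoint G a b Q t l c [] (by omega)
      (by
        rw [List.nil_append, List.nodup_append]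
        refine ⟨hl, hc2, ?_⟩
        rintro x hx y hy rfl
        exact (hc3 x hy).1.2 hx)
      (by
        intro x hx
        simp only [List.nil_append, List.mem_append] at hx
        exact hx.elim (hlQ x) fun h => (hc3 x h).1.1)
      (by simpa using h1) (by simpa using h)
    simpa [hlm] using this
  · have := exists_interior_of_disjoint G a b Q t c l' [] (by omega)
      (by
        rw [List.nil_append, List.nodup_append]
        refine ⟨hc2, hl', ?_⟩
        rintro x hx y hy rfl
        exact (hc3 x hx).2 hy)
      (by
        intro x hx
        simp only [List.nil_append, List.mem_append] at hx
        exact hx.elim (fun h => (hc3 x h).1.1) (hlQ' x))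
      (by simpa using h.trans (Nat.le_succ t)) (by simpa using h2)
    simpa [hc1] using this

end Lists

/-! ### Cherries, matchings and chains rich in edges -/

section Forests

variable {V : Type*} [Fintype V]

open scoped Classical in
/-- Vertex-disjoint cherries (paths with two edges) centered at prescribed vertices, chosen greedily
and written one after the other. -/
lemma exists_cherries (G : SimpleGraph V) (hs : List V) (hnd : hs.Nodup) :
    ∀ F : Finset V, (∀ h ∈ hs, h ∉ F) →
    (∀ h ∈ hs, 3 * hs.length ≤ (G.neighborFinset h \ F).card + 1) →
    ∃ l : List V, l.length = 3 * hs.length ∧ l.Nodup ∧ (∀ x ∈ l, x ∉ F) ∧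
      2 * hs.length ≤ chainCount G l := by
  induction hs with
  | nil => intro F _ _; exact ⟨[], by simp⟩
  | cons h hs ih =>
    intro F hF hdeg
    have hh := hdeg h (by simp)
    obtain ⟨x, hx, y, hy, hxy⟩ : ∃ x ∈ (G.neighborFinset h \ F) \ hs.toFinset,
        ∃ y ∈ (G.neighborFinset h \ F) \ hs.toFinset, x ≠ y := by
      apply Finset.one_lt_card.1
      have := Finset.le_card_sdiff hs.toFinset (G.neighborFinset h \ F)
      have := List.toFinset_card_le hs
      simp at hh
      omega
    simp only [Finset.mem_sdiff, SimpleGraph.mem_neighborFinset, List.mem_toFinset] at hx hy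
    obtain ⟨l, hl1, hl2, hl3, hl4⟩ := ih hnd.of_cons (F ∪ {x, h, y})
      (by
        intro z hz
        have hzh : z ≠ h := by rintro rfl; simp [hz] at hnd
        have hzx : z ≠ x := by rintro rfl; exact hx.2 hz
        have hzy : z ≠ y := by rintro rfl; exact hy.2 hz
        simp [hF z (by simp [hz]), hzh, hzx, hzy])
      (by
        intro z hz
        have h1 := hdeg z (by simp [hz])
        have h2 : ({x, h, y} : Finset V).card ≤ 3 := Finset.card_le_three
        have h3 := Finset.le_card_sdiff {x, h, y} (G.neighborFinset z \ F)
        rw [sdiff_sdiff_left] at h3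
        simp only [List.length_cons] at h1
        change _ ≤ (G.neighborFinset z \ (F ⊔ {x, h, y})).card + 1
        omega)
    simp only [Finset.mem_union, Finset.mem_insert, Finset.mem_singleton, not_or] at hl3
    have hxh : x ≠ h := hx.1.1.ne'
    have hhy : h ≠ y := hy.1.1.ne
    refine ⟨[x, h, y] ++ l, by simp [hl1]; omega, ?_, ?_, ?_⟩
    · refine List.nodup_append.2 ⟨by simp [hxh, hxy, hhy], hl2, ?_⟩
      rintro u hu v hv rfl
      have := hl3 u hv
      simp at hu; tauto
    · intro z hz
      simp only [List.mem_append, List.mem_cons, List.not_mem_nil, or_false] at hz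
      rcases hz with (rfl | rfl | rfl) | hz
      · exact hx.1.2
      · exact hF z (by simp)
      · exact hy.1.2
      · exact (hl3 z hz).1
    · have := add_chainCount_le_append G [x, h, y] l
      simp [adjInd_of_adj hx.1.1.symm, adjInd_of_adj hy.1.1] at this ⊢
      omega

open scoped Classical in
/-- The edges of `G` that have no endpoint in `F`. -/
noncomputable def edgesAvoiding (G : SimpleGraph V) (F : Finset V) : Finset (Sym2 V) :=
  G.edgeFinset.filter fun e => ∀ x ∈ F, x ∉ e

open scoped Classical in
lemma card_edgesAvoiding_le (G : SimpleGraph V) (F F' : Finset V) :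
    (edgesAvoiding G F).card ≤ (edgesAvoiding G (F ∪ F')).card + ∑ x ∈ F', G.degree x := by
  have hsub : edgesAvoiding G F ⊆
      edgesAvoiding G (F ∪ F') ∪ F'.biUnion fun x => G.incidenceFinset x := by
    intro e he
    simp only [edgesAvoiding, Finset.mem_union, Finset.mem_filter, Finset.mem_biUnion,
      SimpleGraph.mem_incidenceFinset, SimpleGraph.incidenceSet, Set.mem_ofPred_eq,
      SimpleGraph.mem_edgeFinset] at he ⊢
    by_cases h : ∃ x ∈ F', x ∈ e
    · obtain ⟨x, hx, hxe⟩ := h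
      exact Or.inr ⟨x, hx, he.1, hxe⟩
    · push Not at h
      exact Or.inl ⟨he.1, fun x hx => hx.elim (he.2 x) (h x)⟩
  calc (edgesAvoiding G F).card
      ≤ (edgesAvoiding G (F ∪ F')).card + (F'.biUnion fun x => G.incidenceFinset x).card :=
        (Finset.card_le_card hsub).trans (Finset.card_union_le _ _)
    _ ≤ _ := by
        gcongr
        refine Finset.card_biUnion_le.trans_eq (Finset.sum_congr rfl fun x _ => ?_)
        exact G.card_incidenceFinset_eq_degree x

open scoped Classical in
/-- A matching of prescribed size, chosen greedily and written as a list. -/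
lemma exists_matching (G : SimpleGraph V) (Δ m : ℕ) (hΔ : 1 ≤ Δ) :
    ∀ F : Finset V, (∀ x, x ∉ F → G.degree x ≤ Δ) → 2 * Δ * m ≤ (edgesAvoiding G F).card →
    ∃ l : List V, l.length = 2 * m ∧ l.Nodup ∧ (∀ x ∈ l, x ∉ F) ∧ m ≤ chainCount G l := by
  induction m with
  | zero => intro F _ _; exact ⟨[], by simp⟩
  | succ m ih =>
    intro F hdeg hF
    obtain ⟨e, he⟩ : (edgesAvoiding G F).Nonempty := by
      rw [← Finset.card_pos]
      have : 0 < 2 * Δ * (m + 1) := by positivity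
      omega
    induction e with
    | _ x y =>
    simp only [edgesAvoiding, Finset.mem_filter, SimpleGraph.mem_edgeFinset,
      SimpleGraph.mem_edgeSet] at he
    obtain ⟨hadj, hav⟩ := he
    have hx : x ∉ F := fun h => hav x h (by simp)
    have hy : y ∉ F := fun h => hav y h (by simp)
    have hxy := hadj.ne
    obtain ⟨l, hl1, hl2, hl3, hl4⟩ := ih (F ∪ {x, y})
      (fun z hz => hdeg z fun h => hz (by simp [h])) (by
        have h1 := card_edgesAvoiding_le G F {x, y}
        rw [Finset.sum_pair hxy] at h1
        have := hdeg x hx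
        have := hdeg y hy
        have : 2 * Δ * (m + 1) = 2 * Δ * m + 2 * Δ := by ring
        omega)
    simp only [Finset.mem_union, Finset.mem_insert, Finset.mem_singleton, not_or] at hl3
    refine ⟨[x, y] ++ l, by simp [hl1]; omega, ?_, ?_, ?_⟩
    · refine List.nodup_append.2 ⟨by simp [hxy], hl2, ?_⟩
      rintro u hu v hv rfl
      have := hl3 u hv
      simp at hu; tauto
    · intro z hz
      simp only [List.mem_append, List.mem_cons, List.not_mem_nil, or_false] at hz
      rcases hz with (rfl | rfl) | hz
      · exact hx
      · exact hy
      · exact (hl3 z hz).1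
    · have := add_chainCount_le_append G [x, y] l
      simp [adjInd_of_adj hadj] at this ⊢
      omega

open scoped Classical in
/-- The vertices of degree greater than `4 * k`. -/
noncomputable def highVertices (G : SimpleGraph V) (k : ℕ) : Finset V :=
  Finset.univ.filter fun x => 4 * k < G.degree x

open scoped Classical in
lemma mem_highVertices {G : SimpleGraph V} {k : ℕ} {x : V} :
    x ∈ highVertices G k ↔ 4 * k < G.degree x := by
  simp [highVertices]

open scoped Classical in
/-- If `k` vertices of high degree lie outside `Q`, then `k` disjoint cherries avoid `Q`, and
dropping one leaf leaves room for them in a chain of `4 * k - 3` vertices. -/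
lemma exists_chain_of_highVertices (G : SimpleGraph V) {k : ℕ} (hk : 2 ≤ k) {Q : Finset V}
    (hQ : Q.card ≤ 4) (hS : k ≤ (highVertices G k \ Q).card) :
    ∃ l : List V, l.length ≤ 4 * k - 3 ∧ l.Nodup ∧ (∀ x ∈ l, x ∉ Q) ∧
      2 * k - 1 ≤ chainCount G l := by
  obtain ⟨T, hT, hTk⟩ := Finset.exists_subset_card_eq hS
  obtain ⟨l, hl1, hl2, hl3, hl4⟩ := exists_cherries G T.toList T.nodup_toList Q
    (fun h hh => (Finset.mem_sdiff.1 (hT (Finset.mem_toList.1 hh))).2)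
    (fun h hh => by
      have h1 := mem_highVertices.1 (Finset.mem_sdiff.1 (hT (Finset.mem_toList.1 hh))).1
      have h2 := Finset.le_card_sdiff Q (G.neighborFinset h)
      rw [SimpleGraph.card_neighborFinset_eq_degree] at h2
      rw [Finset.length_toList]
      omega)
  rw [Finset.length_toList] at hl1 hl4
  cases l with
  | nil => simp only [List.length_nil] at hl1; omega
  | cons x l =>
    have := chainCount_cons_le G x l
    simp at hl1
    exact ⟨l, by omega, hl2.of_cons, fun z hz => hl3 z (by simp [hz]), by omega⟩

open scoped Classical in
/-- If all vertices of `Q` have low degree, the number of edges alone provides the chain: cherries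
at the fewer than `k` vertices of high degree are completed by a matching, which exists since the
graph outside these vertices has bounded degree and still many edges. -/
lemma exists_chain_of_card_edges (G : SimpleGraph V) {k : ℕ} (hk : 2 ≤ k)
    (hV : 16 * k ≤ Fintype.card V + 5) {Q : Finset V}
    (hQ : Q.card ≤ 4) (hQS : Disjoint Q (highVertices G k))
    (hE : (k - 1) * Fintype.card V + 12 * k ^ 2 + 3 * k ≤ G.edgeFinset.card) :
    ∃ l : List V, l.length ≤ 4 * k - 3 ∧ l.Nodup ∧ (∀ x ∈ l, x ∉ Q) ∧
      2 * k - 1 ≤ chainCount G l := by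
  set S := highVertices G k with hSdef
  set n := Fintype.card V with hn
  by_cases hSk : k ≤ S.card
  · apply exists_chain_of_highVertices G hk hQ
    rwa [← hSdef, Finset.sdiff_eq_self_of_disjoint hQS.symm]
  push Not at hSk
  have hlow : ∀ x, x ∉ S → G.degree x ≤ 4 * k := fun x hx => by
    rw [hSdef, mem_highVertices] at hx; omega
  have hdegS : ∑ x ∈ S, G.degree x ≤ S.card * n := by
    rw [← smul_eq_mul]
    exact Finset.sum_le_card_nsmul _ _ _ fun x _ => (G.degree_lt_card_verts x).le
  have hdegQ : ∑ x ∈ Q, G.degree x ≤ 16 * k := by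
    calc _ ≤ Q.card • (4 * k) := Finset.sum_le_card_nsmul _ _ _ fun x hx =>
          hlow x (Finset.disjoint_left.1 hQS hx)
      _ ≤ 4 • (4 * k) := by gcongr
      _ = 16 * k := by simp; ring
  have h0 : (edgesAvoiding G ∅).card = G.edgeFinset.card := by simp [edgesAvoiding]
  have h1 := card_edgesAvoiding_le G ∅ S
  have h2 := card_edgesAvoiding_le G (∅ ∪ S) Q
  rw [Finset.empty_union] at h1 h2
  have hE' : (k - 1) * n + 12 * k ^ 2 + 3 * k ≤
      (edgesAvoiding G (S ∪ Q)).card + 16 * k + S.card * n := by omega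
  obtain ⟨j, hj⟩ : ∃ j, k = S.card + 1 + j := ⟨k - (S.card + 1), by omega⟩
  have hjn : (k - 1) * n = S.card * n + j * n := by
    rw [← add_mul]; congr 1; omega
  have hjn' : j * (16 * k) ≤ j * n + j * 5 := by rw [← mul_add]; gcongr
  rcases Nat.eq_zero_or_pos S.card with hs | hs
  · -- without vertices of high degree, one cherry is needed for the chain to be short enough
    rw [Finset.card_eq_zero] at hs
    rw [hs] at hE' hlow hj
    simp only [Finset.empty_union, Finset.card_empty, zero_mul, zero_add, add_zero] at hE' hj
    have hlow' : ∀ x, G.degree x ≤ 4 * k := fun x => hlow x (by simp)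
    obtain ⟨h, hhQ, hh⟩ : ∃ h, h ∉ Q ∧ 2 ≤ (G.neighborFinset h \ Q).card := by
      by_contra! hcon
      have hsum := G.sum_degrees_eq_twice_card_edges
      have hcount : ∑ x, (G.neighborFinset x ∩ Q).card = ∑ x ∈ Q, G.degree x := by
        have := Finset.sum_card_bipartiteAbove_eq_sum_card_bipartiteBelow (s := Finset.univ)
          (t := Q) G.Adj
        convert this using 2 with x _ x _
        · congr 1; ext y; simp [Finset.bipartiteAbove, and_comm]
        · rw [← SimpleGraph.card_neighborFinset_eq_degree]
          congr 1; ext y; simp [Finset.bipartiteBelow, G.adj_comm]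
      have hle : ∑ x, G.degree x ≤ ∑ x, ((G.neighborFinset x ∩ Q).card + 1 +
          if x ∈ Q then 4 * k else 0) := by
        refine Finset.sum_le_sum fun x _ => ?_
        have h3 := hlow' x
        have h4 := Finset.card_inter_add_card_sdiff (G.neighborFinset x) Q
        rw [SimpleGraph.card_neighborFinset_eq_degree] at h4
        split_ifs with hx
        · omega
        · have := hcon x hx
          omega
      rw [Finset.sum_add_distrib, Finset.sum_add_distrib, hcount, hsum,
        Finset.sum_ite_mem] at hle
      simp only [Finset.sum_const, Finset.card_univ, smul_eq_mul, mul_one,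
        Finset.univ_inter, ← hn] at hle
      have : Q.card * (4 * k) ≤ 4 * (4 * k) := by gcongr
      have : 1 * n ≤ (k - 1) * n := by gcongr; omega
      have : 2 * k ≤ k ^ 2 := by nlinarith
      omega
    obtain ⟨c, hc1, hc2, hc3, hc4⟩ := exists_cherries G [h] (by simp) Q (by simpa using hhQ)
      (by simpa using by omega)
    simp only [List.length_cons, List.length_nil, zero_add, mul_one] at hc1 hc4
    obtain ⟨l, hl1, hl2, hl3, hl4⟩ := exists_matching G (4 * k) (2 * k - 3) (by omega)
      (Q ∪ c.toFinset) (fun x _ => hlow' x) (by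
        have h3 := card_edgesAvoiding_le G Q c.toFinset
        have h4 : ∑ x ∈ c.toFinset, G.degree x ≤ 3 * (4 * k) := by
          calc _ ≤ c.toFinset.card • (4 * k) := Finset.sum_le_card_nsmul _ _ _ fun x _ => hlow' x
            _ ≤ 3 • (4 * k) := by
              gcongr
              exact (List.toFinset_card_le c).trans hc1.le
        obtain ⟨i, rfl⟩ : ∃ i, k = i + 2 := ⟨k - 2, by omega⟩
        obtain rfl : j = i + 1 := by omega
        have h5 : 2 * (i + 2) - 3 = 2 * i + 1 := by omega
        have h6 : i + 2 - 1 = i + 1 := by omega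
        rw [h6] at hE'
        rw [h5]
        nlinarith)
    simp only [Finset.mem_union, List.mem_toFinset, not_or] at hl3
    refine ⟨c ++ l, by simp; omega, ?_, ?_, ?_⟩
    · refine List.nodup_append.2 ⟨hc2, hl2, ?_⟩
      rintro x hx y hy rfl
      exact (hl3 x hy).2 hx
    · intro x hx
      exact (List.mem_append.1 hx).elim (hc3 x) fun h => (hl3 x h).1
    · have := add_chainCount_le_append G c l
      omega
  · -- the `S.card` cherries contribute `2 * S.card` edges, which leaves `2 * j + 1` to be found
    obtain ⟨l, hl1, hl2, hl3, hl4⟩ := exists_matching G (4 * k) (2 * j + 1) (by omega)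
      (S ∪ Q) (fun x hx => hlow x fun h => hx (by simp [h])) (by
        rw [hjn] at hE'
        have : k ^ 2 = k * k := sq k
        nlinarith)
    simp only [Finset.mem_union, not_or] at hl3
    obtain ⟨c, hc1, hc2, hc3, hc4⟩ := exists_cherries G S.toList S.nodup_toList
      (Q ∪ l.toFinset) (fun h hh => by
        rw [Finset.mem_toList] at hh
        simp only [Finset.mem_union, List.mem_toFinset, not_or]
        exact ⟨Finset.disjoint_right.1 hQS hh, fun h' => (hl3 h h').1 hh⟩)
      (fun h hh => by
        have h1 := mem_highVertices.1 (Finset.mem_toList.1 hh)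
        have h2 := Finset.le_card_sdiff (Q ∪ l.toFinset) (G.neighborFinset h)
        have h3 := Finset.card_union_le Q l.toFinset
        have h4 := List.toFinset_card_le l
        rw [SimpleGraph.card_neighborFinset_eq_degree] at h2
        rw [Finset.length_toList]
        omega)
    simp only [Finset.mem_union, List.mem_toFinset, not_or] at hc3
    rw [Finset.length_toList] at hc1 hc4
    refine ⟨l ++ c, by simp; omega, ?_, ?_, ?_⟩
    · refine List.nodup_append.2 ⟨hl2, hc2, ?_⟩
      rintro x hx y hy rfl
      exact (hc3 x hy).2 hx
    · intro x hx
      exact (List.mem_append.1 hx).elim (fun h => (hl3 x h).2) fun h => (hc3 x h).1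
    · have := add_chainCount_le_append G l c
      omega

end Forests

/-! ### Balanced cycles from odd 4-cycles and from vertex covers -/

section Cycles

variable {V : Type*}

/-- A cyclic arrangement of `4 * k` distinct vertices with exactly `2 * k` edges in `G`. -/
def HasBalancedCycle (G : SimpleGraph V) (k : ℕ) : Prop :=
  ∃ l : List V, l.Nodup ∧ l.length = 4 * k ∧ cycleCount G l = 2 * k

/-- The 4-cycle `a v b w` has an odd number of edges in `G`. -/
def IsOddFourCycle (G : SimpleGraph V) (a v b w : V) : Prop :=
  [a, v, b, w].Nodup ∧ Odd (adjInd G a v + adjInd G v b + (adjInd G b w + adjInd G w a))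

lemma IsOddFourCycle.swap {G : SimpleGraph V} {a v b w : V} (h : IsOddFourCycle G a v b w) :
    IsOddFourCycle G a w b v := by
  refine ⟨(List.Perm.cons a ((List.reverse_perm [v, b, w]).symm)).nodup_iff.1 h.1, ?_⟩
  rw [adjInd_comm G a w, adjInd_comm G w b, adjInd_comm G b v, adjInd_comm G v a]
  convert h.2 using 1
  omega

/-- If all 4-cycles on `W` have an even number of edges in `G`, then adjacency in `G` is an additive
function modulo two: on `W`, the graph is a complete bipartite graph or the complement of one. -/
lemma exists_bipartition_of_not_isOddFourCycle (G : SimpleGraph V) (W : Set V)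
    (hW : ∀ a ∈ W, ∀ v ∈ W, ∀ b ∈ W, ∀ w ∈ W, ¬ IsOddFourCycle G a v b w) :
    ∃ X : Set V, (∀ x ∈ W, ∀ y ∈ W, x ≠ y → (G.Adj x y ↔ (x ∈ X ↔ y ∉ X))) ∨
      (∀ x ∈ W, ∀ y ∈ W, x ≠ y → (G.Adj x y ↔ (x ∈ X ↔ y ∈ X))) := by
  classical
  rcases W.eq_empty_or_nonempty with rfl | ⟨r, hr⟩
  · exact ⟨∅, by simp⟩
  let e : V → V → ZMod 2 := fun x y => if G.Adj x y then 1 else 0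
  have he : ∀ x y, e x y = e y x := fun x y => by simp [e, G.adj_comm]
  have hcast : ∀ x y, (adjInd G x y : ZMod 2) = e x y := fun x y => by
    by_cases h : G.Adj x y <;> simp [adjInd, e, h]
  have hsq : ∀ a ∈ W, ∀ v ∈ W, ∀ b ∈ W, ∀ w ∈ W, [a, v, b, w].Nodup →
      e a v + e v b + (e b w + e w a) = 0 := by
    intro a ha v hv b hb w hw hnd
    have := hW a ha v hv b hb w hw
    simp only [IsOddFourCycle, hnd, true_and, Nat.not_odd_iff_even] at this
    rw [← ZMod.natCast_eq_zero_iff_even] at this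
    simpa [hcast] using this
  let g : V → V → ZMod 2 := fun x y => e x y + e r x + e r y
  have hg : ∀ x y, g x y = g y x := fun x y => by simp only [g, he x y]; ring
  -- 4-cycles through the base point `r` show that `g` is constant on pairs
  have hchain : ∀ x ∈ W, ∀ y ∈ W, ∀ z ∈ W, x ≠ r → y ≠ r → z ≠ r → x ≠ y → y ≠ z →
      g x y = g y z := by
    intro x hx y hy z hz hxr hyr hzr hxy hyz
    by_cases hxz : x = z
    · subst hxz; exact hg x y
    have := hsq r hr x hx y hy z hz (by simp [*, Ne.symm hxr, Ne.symm hyr, Ne.symm hzr])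
    rw [he z r] at this
    simp only [g]
    generalize e r x = p1 at *
    generalize e r y = p2 at *
    generalize e r z = p3 at *
    generalize e x y = p4 at *
    generalize e y z = p5 at *
    revert p1 p2 p3 p4 p5
    decide
  obtain ⟨c, hc⟩ : ∃ c, ∀ x ∈ W, ∀ y ∈ W, x ≠ r → y ≠ r → x ≠ y → g x y = c := by
    by_cases h : ∃ x ∈ W, ∃ y ∈ W, x ≠ r ∧ y ≠ r ∧ x ≠ y
    · obtain ⟨x₀, hx₀, y₀, hy₀, hxr, hyr, hxy⟩ := h
      refine ⟨g x₀ y₀, fun x hx y hy hxr' hyr' hxy' => ?_⟩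
      by_cases hy : y = x₀
      · subst hy; exact hchain x hx y hx₀ y₀ hy₀ hxr' hxr hyr hxy' hxy
      · rw [hchain x hx y ‹_› x₀ hx₀ hxr' hyr' hxr hxy' hy,
          hchain y ‹_› x₀ hx₀ y₀ hy₀ hyr' hxr hyr hy hxy]
    · push Not at h
      exact ⟨0, fun x hx y hy h1 h2 h3 => (h3 (h x hx y hy h1 h2)).elim⟩
  let f : V → ZMod 2 := fun x => if x = r then c else e r x
  have hf : ∀ x ∈ W, ∀ y ∈ W, x ≠ y → e x y = f x + f y + c := by
    intro x hx y hy hxy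
    have two : c + c = 0 := CharTwo.add_self_eq_zero c
    by_cases hxr : x = r
    · subst hxr
      simp only [f, if_true, if_neg hxy.symm]
      linear_combination -two
    by_cases hyr : y = r
    · subst hyr
      simp only [f, if_true, if_neg hxy, he x y]
      linear_combination -two
    have := hc x hx y hy hxr hyr hxy
    simp only [f, if_neg hxr, if_neg hyr]
    simp only [g] at this
    linear_combination this - CharTwo.add_self_eq_zero (e r x) - CharTwo.add_self_eq_zero (e r y)
  have hadj : ∀ x y, G.Adj x y ↔ e x y = 1 := fun x y => by
    by_cases h : G.Adj x y <;> simp [e, h]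
  refine ⟨{x | f x = 1}, ?_⟩
  have hc01 : c = 0 ∨ c = 1 := (by decide : ∀ c : ZMod 2, c = 0 ∨ c = 1) c
  refine hc01.imp (fun h x hx y hy hxy => ?_) (fun h x hx y hy hxy => ?_)
  all_goals
    rw [hadj, hf x hx y hy hxy, h]
    simp only [Set.mem_ofPred_eq]
    generalize f x = p
    generalize f y = q
    revert p q
    decide

variable [Fintype V]

open scoped Classical in
/-- Let every edge of `G` meet `A`. A cyclic arrangement of disjoint cherries centered at `k` vertices
of `A`, filled up with vertices outside `A`, has exactly the edges of these cherries in `G`. -/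
lemma hasBalancedCycle_of_cover (G : SimpleGraph V) (k : ℕ) (A : Finset V)
    (hA : ∀ x y, G.Adj x y → x ∈ A ∨ y ∈ A) (hk : k ≤ A.card)
    (hdeg : ∀ h ∈ A, 3 * k ≤ (G.neighborFinset h \ A).card + 1)
    (hV : A.card + 4 * k ≤ Fintype.card V) : HasBalancedCycle G k := by
  obtain ⟨T, hT, hTk⟩ := Finset.exists_subset_card_eq hk
  obtain ⟨l, hl1, hl2, hl3, hl4⟩ := exists_cherries G T.toList T.nodup_toList (A \ T)
    (fun h hh => by simp [Finset.mem_toList.1 hh])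
    (fun h hh => by
      rw [Finset.length_toList, hTk]
      refine (hdeg h (hT (Finset.mem_toList.1 hh))).trans ?_
      gcongr
      exact Finset.sdiff_subset)
  rw [Finset.length_toList, hTk] at hl1 hl4
  obtain ⟨l', h1, h2, h3⟩ := exists_nodup_extension A (4 * k) hV hl2 (by omega)
  refine ⟨l ++ l', h2, h1, le_antisymm ?_ ?_⟩
  · refine (cycleCount_le_two_mul_countP G hA _).trans ?_
    gcongr
    rw [List.countP_eq_length_filter, ← List.toFinset_card_of_nodup (h2.filter _), ← hTk]
    apply Finset.card_le_card
    intro x hx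
    simp only [List.mem_toFinset, List.mem_filter, List.mem_append, decide_eq_true_eq] at hx
    have := hl3 x
    have := h3 x
    simp only [Finset.mem_sdiff] at *
    tauto
  · have h4 := add_chainCount_le_append G l l'
    have h5 : chainCount G (l ++ l') ≤ cycleCount G (l ++ l') := by
      cases l ++ l' with
      | nil => simp
      | cons x c =>
        have := add_chainCount_le_append G (x :: c) [x]
        simp only [cycleCount]
        omega
    omega

/-- The swapping argument: exchanging `v` and `w` in a cycle through `a v b` changes its number of
edges in `G` by exactly one, and the remaining chain from `b` to `a` can be chosen with one of two
prescribed consecutive numbers of edges in `G`. -/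
lemma IsOddFourCycle.hasBalancedCycle {G : SimpleGraph V} {k : ℕ} (hk : 1 ≤ k)
    (hV : 12 * k ≤ Fintype.card V + 5) {a v b w : V} (hodd : IsOddFourCycle G a v b w)
    {Q : Finset V} (hQ : ∀ x, x ∈ Q ↔ x ∈ [a, v, b, w])
    (h1 : ∃ l : List V, l.length ≤ 4 * k - 3 ∧ l.Nodup ∧ (∀ x ∈ l, x ∉ Q) ∧
      2 * k - 1 ≤ chainCount G l)
    (h2 : ∃ l : List V, l.length ≤ 4 * k - 3 ∧ l.Nodup ∧ (∀ x ∈ l, x ∉ Q) ∧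
      2 * k - 1 ≤ chainCount Gᶜ l) : HasBalancedCycle G k := by
  classical
  -- by symmetry, the path through `v` may be assumed to have one edge more than that through `w`
  wlog hvw : adjInd G a v + adjInd G v b = adjInd G b w + adjInd G w a + 1 generalizing v w
  · refine this hodd.swap (fun x => ?_) ?_
    · rw [hQ]; simp; tauto
    · have := adjInd_le_one G a v
      have := adjInd_le_one G v b
      have := adjInd_le_one G b w
      have := adjInd_le_one G w a
      obtain ⟨m, hm⟩ := hodd.2
      rw [adjInd_comm G a w, adjInd_comm G w b, adjInd_comm G b v, adjInd_comm G v a]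
      omega
  have hQc : Q.card ≤ 4 := by
    have : Q = [a, v, b, w].toFinset := by ext x; simp [hQ]
    rw [this]
    exact List.toFinset_card_le _
  obtain ⟨l₁, hl₁, hn₁, hq₁, hc₁⟩ := h1
  obtain ⟨l₂, hl₂, hn₂, hq₂, hc₂⟩ := h2
  obtain ⟨e₁, he₁, hne₁, hqe₁⟩ := exists_nodup_extension Q (4 * k - 3) (by omega) hn₁ hl₁
  obtain ⟨e₂, he₂, hne₂, hqe₂⟩ := exists_nodup_extension Q (4 * k - 3) (by omega) hn₂ hl₂
  have hq₁' : ∀ x ∈ l₁ ++ e₁, x ∉ Q := fun x hx =>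
    (List.mem_append.1 hx).elim (hq₁ x) (hqe₁ x)
  have hq₂' : ∀ x ∈ l₂ ++ e₂, x ∉ Q := fun x hx =>
    (List.mem_append.1 hx).elim (hq₂ x) (hqe₂ x)
  have hle : ∀ (H : SimpleGraph V) (l e : List V),
      chainCount H l ≤ chainCount H (b :: (l ++ e) ++ [a]) := by
    intro H l e
    have := add_chainCount_le_append H l e
    have := add_chainCount_le_append H (l ++ e) [a]
    have := chainCount_le_cons H b ((l ++ e) ++ [a])
    simp only [List.cons_append] at *
    omega
  have hnd := hodd.1
  simp only [List.nodup_cons, List.mem_cons, List.not_mem_nil, or_false, not_or] at hnd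
  have hend : ∀ l : List V, l.Nodup → (∀ x ∈ l, x ∉ Q) → (b :: l ++ [a]).Nodup := by
    intro l hl hlQ
    have ha : a ∉ l := fun h => hlQ a h ((hQ a).2 (by simp))
    have hb : b ∉ l := fun h => hlQ b h ((hQ b).2 (by simp))
    have : (b :: l ++ [a]).Perm (b :: a :: l) :=
      List.Perm.cons b (List.perm_append_singleton a l)
    rw [this.nodup_iff]
    simp [ha, hb, hl, Ne.symm hnd.1.2.1]
  have hlow := chainCount_add_compl G (hend _ hne₂ hq₂')
  have := hle G l₁ e₁
  have := hle Gᶜ l₂ e₂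
  have hb1 := adjInd_le_one G a v
  have hb2 := adjInd_le_one G v b
  have hlen2 : (b :: (l₂ ++ e₂) ++ [a]).length = 4 * k - 3 + 2 := by
    simp only [List.length_append, List.length_cons, List.length_nil] at he₂ ⊢; omega
  obtain ⟨l, hl1, hl2, hl3, hl4⟩ := exists_interior G a b Q
    (2 * k - (adjInd G a v + adjInd G v b)) (4 * k - 3) (by omega)
    hne₂ hq₂' he₂ hne₁ hq₁' he₁ (by omega) (by omega)
  have hclose : ∀ x : V, x ∈ Q → x ≠ a → x ≠ b →
      (x :: (b :: l ++ [a])).Nodup ∧ (x :: (b :: l ++ [a])).length = 4 * k ∧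
      cycleCount G (x :: (b :: l ++ [a])) =
        chainCount G (b :: l ++ [a]) + (adjInd G a x + adjInd G x b) := by
    intro x hx hxa hxb
    refine ⟨List.nodup_cons.2 ⟨?_, hend l hl2 hl3⟩, by simp; omega, ?_⟩
    · have : x ∉ l := fun h => hl3 x h hx
      simp [this, hxa, hxb]
    · have := chainCount_append_pair G (b :: l) a x
      simp only [cycleCount, List.cons_append, chainCount_cons_cons, List.append_assoc,
        List.nil_append] at this ⊢
      omega
  rcases hl4 with hl4 | hl4
  · obtain ⟨c1, c2, c3⟩ := hclose v ((hQ v).2 (by simp)) (Ne.symm hnd.1.1) hnd.2.1.1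
    exact ⟨_, c1, c2, by omega⟩
  · obtain ⟨c1, c2, c3⟩ := hclose w ((hQ w).2 (by simp)) (Ne.symm hnd.1.2.2)
      (Ne.symm hnd.2.2.1)
    rw [adjInd_comm G a w, adjInd_comm G w b] at c3
    exact ⟨_, c1, c2, by omega⟩

end Cycles

/-! ### Colorings with large color classes, for `k ≥ 2` -/

section Main

variable {V : Type*}

lemma card_edgeFinset_eq_ncard (G : SimpleGraph V) [Fintype G.edgeSet] :
    G.edgeFinset.card = G.edgeSet.ncard :=
  (Set.ncard_eq_toFinset_card' _).symm

variable [Fintype V]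

open scoped Classical in
lemma card_edgeFinset_le_of_cover (G : SimpleGraph V) (A : Finset V)
    (hA : ∀ x y, G.Adj x y → x ∈ A ∨ y ∈ A) :
    G.edgeFinset.card ≤ A.card * (Fintype.card V - 1) := by
  have h1 := card_edgesAvoiding_le G ∅ A
  have h2 : edgesAvoiding G (∅ ∪ A) = ∅ := by
    refine Finset.eq_empty_of_forall_notMem fun e he => ?_
    induction e with
    | _ x y =>
    simp only [edgesAvoiding, Finset.empty_union, Finset.mem_filter, SimpleGraph.mem_edgeFinset,
      SimpleGraph.mem_edgeSet] at he
    rcases hA x y he.1 with h | h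
    · exact he.2 x h (by simp)
    · exact he.2 y h (by simp)
  have h3 : (edgesAvoiding G ∅).card = G.edgeFinset.card := by simp [edgesAvoiding]
  have h4 : ∑ x ∈ A, G.degree x ≤ A.card * (Fintype.card V - 1) := by
    rw [← smul_eq_mul]
    exact Finset.sum_le_card_nsmul _ _ _ fun x _ => by
      have := G.degree_lt_card_verts x
      omega
  rw [h2, Finset.card_empty] at h1
  omega

lemma two_mul_ncard_edgeSet_add_compl (G : SimpleGraph V) :
    2 * G.edgeSet.ncard + 2 * Gᶜ.edgeSet.ncard = Fintype.card V * (Fintype.card V - 1) := by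
  classical
  rw [← card_edgeFinset_eq_ncard G, ← card_edgeFinset_eq_ncard Gᶜ]
  rw [← G.sum_degrees_eq_twice_card_edges, ← Gᶜ.sum_degrees_eq_twice_card_edges,
    ← Finset.sum_add_distrib, ← smul_eq_mul, ← Finset.card_univ]
  refine Finset.sum_const_nat fun x _ => ?_
  rw [SimpleGraph.degree_compl, Finset.card_univ]
  have := G.degree_lt_card_verts x
  omega

open scoped Classical in
/-- A graph with at least half of all possible edges has many vertices of high degree. -/
lemma add_four_le_card_highVertices (G : SimpleGraph V) {k : ℕ}
    (hV : 10 * k + 7 ≤ Fintype.card V)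
    (hE : Fintype.card V * (Fintype.card V - 1) ≤ 4 * G.edgeSet.ncard) :
    k + 4 ≤ (highVertices G k).card := by
  by_contra! hS
  have h2 := G.sum_degrees_eq_twice_card_edges
  rw [card_edgeFinset_eq_ncard] at h2
  obtain ⟨r, hr⟩ : ∃ r, Fintype.card V = 10 * k + 7 + r := ⟨_, (Nat.add_sub_cancel' hV).symm⟩
  have h3 : ∑ x, G.degree x ≤
      ∑ x, (4 * k + if x ∈ highVertices G k then 6 * k + 6 + r else 0) := by
    refine Finset.sum_le_sum fun x _ => ?_
    have := G.degree_lt_card_verts x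
    split_ifs with hx
    · omega
    · rw [mem_highVertices] at hx
      omega
  rw [Finset.sum_add_distrib, Finset.sum_ite_mem] at h3
  simp only [Finset.sum_const, Finset.card_univ, smul_eq_mul, Finset.univ_inter] at h3
  have h4 : (highVertices G k).card * (6 * k + 6 + r) ≤ (k + 3) * (6 * k + 6 + r) := by
    gcongr; omega
  have h5 : Fintype.card V - 1 = 10 * k + 6 + r := by omega
  rw [h5, hr] at hE
  rw [hr] at h3
  nlinarith

/-- A complete bipartite graph with enough edges: both sides are large, so that `k` vertices of the
smaller side can be distributed over the cycle. -/
lemma hasBalancedCycle_of_cut (G : SimpleGraph V) {k : ℕ} (hV : 8 * k ≤ Fintype.card V)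
    (hE : (k - 1) * Fintype.card V < G.edgeSet.ncard) (X : Set V)
    (hX : ∀ x y, x ≠ y → (G.Adj x y ↔ (x ∈ X ↔ y ∉ X))) : HasBalancedCycle G k := by
  classical
  wlog hle : 2 * X.toFinset.card ≤ Fintype.card V generalizing X
  · refine this Xᶜ (fun x y hxy => ?_) ?_
    · rw [hX x y hxy]; simp only [Set.mem_compl_iff]; tauto
    · rw [Set.toFinset_compl, Finset.card_compl]; omega
  have hadj : ∀ x y, G.Adj x y ↔ (x ∈ X ↔ y ∉ X) := fun x y => by
    by_cases h : x = y
    · subst h; simp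
    · exact hX x y h
  have hcov : ∀ x y, G.Adj x y → x ∈ X.toFinset ∨ y ∈ X.toFinset := fun x y h => by
    rw [hadj] at h; simp only [Set.mem_toFinset]; tauto
  refine hasBalancedCycle_of_cover G k X.toFinset hcov ?_ (fun h hh => ?_) (by omega)
  · by_contra! hcon
    have h1 := card_edgeFinset_le_of_cover G X.toFinset hcov
    have h2 : X.toFinset.card * (Fintype.card V - 1) ≤ (k - 1) * Fintype.card V := by
      gcongr <;> omega
    rw [card_edgeFinset_eq_ncard] at h1
    omega
  · have : G.neighborFinset h \ X.toFinset = X.toFinsetᶜ := by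
      ext y
      simp only [Set.mem_toFinset] at hh
      simp [hadj, hh]
    rw [this, Finset.card_compl]
    omega

open scoped Classical in
/-- Low degrees on a large set `W` without odd 4-cycles leave only one possibility: no edges. -/
lemma not_adj_of_not_isOddFourCycle (G : SimpleGraph V) {d : ℕ} (W : Finset V)
    (hW : ∀ a ∈ W, ∀ v ∈ W, ∀ b ∈ W, ∀ w ∈ W, ¬ IsOddFourCycle G a v b w)
    (hdeg : ∀ x ∈ W, G.degree x ≤ d) (hcard : 2 * d + 3 ≤ W.card) :
    ∀ x ∈ W, ∀ y ∈ W, ¬ G.Adj x y := by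
  obtain ⟨X, hX⟩ := exists_bipartition_of_not_isOddFourCycle G (W : Set V) (by simpa using hW)
  have hsplit := Finset.card_filter_add_card_filter_not (s := W) (· ∈ X)
  rcases hX with hX | hX
  · have key : ∀ x ∈ W, ∀ y ∈ W, x ∈ X → y ∉ X → False := by
      intro x hx y hy hxX hyX
      have h1 : (W.filter (· ∉ X)).card ≤ d := by
        refine le_trans (Finset.card_le_card fun z hz => ?_) (hdeg x hx)
        rw [Finset.mem_filter] at hz
        rw [SimpleGraph.mem_neighborFinset, hX x hx z hz.1 (by rintro rfl; exact hz.2 hxX)]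
        tauto
      have h2 : (W.filter (· ∈ X)).card ≤ d := by
        refine le_trans (Finset.card_le_card fun z hz => ?_) (hdeg y hy)
        rw [Finset.mem_filter] at hz
        rw [SimpleGraph.mem_neighborFinset, hX y hy z hz.1 (by rintro rfl; exact hyX hz.2)]
        tauto
      omega
    intro x hx y hy h
    have := (hX x hx y hy h.ne).1 h
    by_cases hxX : x ∈ X
    · exact key x hx y hy hxX (by tauto)
    · exact key y hy x hx (by tauto) hxX
  · have key : ∀ (P : V → Prop) [DecidablePred P],
        (∀ x ∈ W, ∀ y ∈ W, P x → P y → x ≠ y → G.Adj x y) →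
        (W.filter P).card ≤ d + 1 := by
      intro P _ hP
      rcases (W.filter P).eq_empty_or_nonempty with h | ⟨x, hx⟩
      · simp [h]
      · rw [← Finset.card_erase_add_one hx]
        gcongr
        rw [Finset.mem_filter] at hx
        refine le_trans (Finset.card_le_card fun z hz => ?_) (hdeg x hx.1)
        rw [Finset.mem_erase, Finset.mem_filter] at hz
        rw [SimpleGraph.mem_neighborFinset]
        exact hP x hx.1 z hz.2.1 hx.2 hz.2.2 hz.1.symm
    have h1 := key (· ∈ X) fun x hx y hy h h' hne => (hX x hx y hy hne).2 (by tauto)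
    have h2 := key (· ∉ X) fun x hx y hy h h' hne => (hX x hx y hy hne).2 (by tauto)
    omega

open scoped Classical in
/-- The combinatorial core for `k ≥ 2`: if `G` is the sparser color, a balanced cycle arises from an
odd 4-cycle that does not waste vertices of high degree, or else `G` is too simple not to have
one. -/
theorem hasBalancedCycle_or_compl (G : SimpleGraph V) {k : ℕ} (hk : 2 ≤ k)
    (hV : 16 * k ≤ Fintype.card V + 5) (hV' : 10 * k + 7 ≤ Fintype.card V)
    (hE : (k - 1) * Fintype.card V + 12 * k ^ 2 + 3 * k ≤ G.edgeSet.ncard)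
    (hE' : G.edgeSet.ncard ≤ Gᶜ.edgeSet.ncard) :
    HasBalancedCycle G k ∨ HasBalancedCycle Gᶜ k := by
  set S := highVertices G k with hS
  have hk0 : 0 < 12 * k ^ 2 := by positivity
  have hhigh := add_four_le_card_highVertices Gᶜ hV' (by
    have := two_mul_ncard_edgeSet_add_compl G
    omega)
  have hQ4 : ∀ a v b w : V, ({a, v, b, w} : Finset V).card ≤ 4 := fun _ _ _ _ =>
    Finset.card_le_four
  by_cases hodd : ∃ a v b w, IsOddFourCycle G a v b w ∧
      (k ≤ (S \ {a, v, b, w}).card ∨ Disjoint {a, v, b, w} S)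
  · obtain ⟨a, v, b, w, h, hor⟩ := hodd
    refine Or.inl (h.hasBalancedCycle (by omega) (by omega) (Q := {a, v, b, w}) (by simp) ?_ ?_)
    · rcases hor with hor | hor
      · exact exists_chain_of_highVertices G hk (hQ4 ..) hor
      · exact exists_chain_of_card_edges G hk hV (hQ4 ..) hor
          (by rwa [card_edgeFinset_eq_ncard])
    · refine exists_chain_of_highVertices Gᶜ hk (hQ4 ..) ?_
      have := Finset.le_card_sdiff {a, v, b, w} (highVertices Gᶜ k)
      have := hQ4 a v b w
      omega
  push Not at hodd
  rcases le_or_gt (k + 4) S.card with hSk | hSk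
  · -- removing any four vertices leaves `k` of high degree, so there is no odd 4-cycle at all
    obtain ⟨X, hX⟩ := exists_bipartition_of_not_isOddFourCycle G Set.univ (by
      intro a _ v _ b _ w _ h
      have := (hodd a v b w h).1
      have := Finset.le_card_sdiff {a, v, b, w} S
      have := hQ4 a v b w
      omega)
    simp only [Set.mem_univ, true_implies] at hX
    rcases hX with hX | hX
    · exact Or.inl (hasBalancedCycle_of_cut G (by omega) (by omega) X hX)
    · refine Or.inr (hasBalancedCycle_of_cut Gᶜ (by omega) (by omega) X fun x y hxy => ?_)
      rw [SimpleGraph.compl_adj, hX x y hxy]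
      tauto
  · have hnone := not_adj_of_not_isOddFourCycle G (d := 4 * k) Sᶜ
      (by
        intro a ha v hv b hb w hw h
        rw [Finset.mem_compl] at ha hv hb hw
        refine (hodd a v b w h).2 ?_
        simp [Finset.disjoint_left, ha, hv, hb, hw])
      (fun x hx => by
        rw [Finset.mem_compl, hS, mem_highVertices] at hx
        omega)
      (by rw [Finset.card_compl]; omega)
    have hcov : ∀ x y, G.Adj x y → x ∈ S ∨ y ∈ S := fun x y h => by
      by_contra! hcon
      exact hnone x (by simpa using hcon.1) y (by simpa using hcon.2) h
    refine Or.inl (hasBalancedCycle_of_cover G k S hcov ?_ (fun h hh => ?_) (by omega))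
    · by_contra! hcon
      have h1 := card_edgeFinset_le_of_cover G S hcov
      rw [card_edgeFinset_eq_ncard] at h1
      have h2 : S.card * (Fintype.card V - 1) ≤ (k - 1) * Fintype.card V := by gcongr <;> omega
      omega
    · have h1 := mem_highVertices.1 hh
      have h2 : G.neighborFinset h \ S = G.neighborFinset h \ S.erase h := by
        ext y
        simp only [Finset.mem_sdiff, SimpleGraph.mem_neighborFinset, Finset.mem_erase]
        exact ⟨fun h => ⟨h.1, fun h' => h.2 h'.2⟩, fun h => ⟨h.1, fun h' => h.2 ⟨h.1.ne', h'⟩⟩⟩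
      have h3 := Finset.le_card_sdiff (S.erase h) (G.neighborFinset h)
      rw [SimpleGraph.card_neighborFinset_eq_degree, Finset.card_erase_of_mem hh] at h3
      rw [h2]
      omega

end Main

/-! ### Balanced 4-cycles -/

section Four

variable {V : Type*}

lemma hasBalancedCycle_one {G : SimpleGraph V} {a x b y : V} (hnd : [a, x, b, y].Nodup)
    (h : adjInd G a x + adjInd G b x + (adjInd G a y + adjInd G b y) = 2) :
    HasBalancedCycle G 1 := by
  refine ⟨[a, x, b, y], hnd, rfl, ?_⟩
  rw [adjInd_comm G b x, adjInd_comm G a y] at h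
  simp only [cycleCount, List.cons_append, List.nil_append, chainCount_cons_cons,
    chainCount_singleton]
  omega

/-- A common neighbour and a common non-neighbour of two vertices form a balanced 4-cycle with
them. -/
lemma not_exists_common_of_not_hasBalancedCycle {G : SimpleGraph V}
    (hG : ¬ HasBalancedCycle G 1) {a b x y : V} (hab : a ≠ b) (hax : G.Adj a x)
    (hbx : G.Adj b x) (hay : Gᶜ.Adj a y) (hby : Gᶜ.Adj b y) : False := by
  refine hG (hasBalancedCycle_one (a := a) (x := x) (b := b) (y := y) ?_ ?_)
  · have hxy : x ≠ y := by
      rintro rfl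
      exact hay.2 hax
    simp [hax.ne, hbx.ne.symm, hay.ne, hby.ne, hab, hxy]
  · have h1 := hay.2
    have h2 := hby.2
    simp [adjInd, hax, hbx, h1, h2]

variable [Fintype V]

open scoped Classical in
/-- Two neighbours `x`, `y` of `a` are not both non-neighbours of `b`, as otherwise `a x b y` is a
balanced 4-cycle. -/
lemma exists_common_neighbor {G : SimpleGraph V} (hG : ¬ HasBalancedCycle G 1) {a b : V}
    (hab : a ≠ b) (h : 3 ≤ G.degree a) : ∃ x, G.Adj a x ∧ G.Adj b x := by
  obtain ⟨x, hx, y, hy, hxy⟩ : ∃ x ∈ (G.neighborFinset a).erase b,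
      ∃ y ∈ (G.neighborFinset a).erase b, x ≠ y := by
    apply Finset.one_lt_card.1
    have := Finset.pred_card_le_card_erase (s := G.neighborFinset a) (a := b)
    rw [SimpleGraph.card_neighborFinset_eq_degree] at this
    omega
  simp only [Finset.mem_erase, SimpleGraph.mem_neighborFinset] at hx hy
  by_contra! hcon
  refine hG (hasBalancedCycle_one (a := a) (x := x) (b := b) (y := y) ?_ ?_)
  · simp [hx.2.ne, hy.2.ne, hab, hx.1, hy.1.symm, hxy]
  · simp [adjInd, hx.2, hy.2, hcon x hx.2, hcon y hy.2]

open scoped Classical in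
/-- Two disjoint edges in a graph of maximum degree at most two on many vertices yield a balanced
4-cycle. -/
lemma hasBalancedCycle_one_of_degree_le_two {G : SimpleGraph V} (hV : 10 ≤ Fintype.card V)
    (hdeg : ∀ x, G.degree x ≤ 2) (hE : 5 ≤ G.edgeFinset.card) : HasBalancedCycle G 1 := by
  by_contra hG
  have hav : ∀ F : Finset V, (edgesAvoiding G F).Nonempty →
      ∃ x y, x ∉ F ∧ y ∉ F ∧ G.Adj x y := by
    rintro F ⟨e, he⟩
    induction e with
    | _ x y =>
    simp only [edgesAvoiding, Finset.mem_filter, SimpleGraph.mem_edgeFinset,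
      SimpleGraph.mem_edgeSet] at he
    exact ⟨x, y, fun h => he.2 x h (by simp), fun h => he.2 y h (by simp), he.1⟩
  have h0 : (edgesAvoiding G ∅).card = G.edgeFinset.card := by simp [edgesAvoiding]
  obtain ⟨x, y, -, -, hxy⟩ := hav ∅ (by rw [← Finset.card_pos]; omega)
  obtain ⟨z, w, hz, hw, hzw⟩ := hav {x, y} (by
    have h1 := card_edgesAvoiding_le G ∅ {x, y}
    rw [Finset.sum_pair hxy.ne, Finset.empty_union] at h1
    have := hdeg x
    have := hdeg y
    rw [← Finset.card_pos]
    omega)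
  simp only [Finset.mem_insert, Finset.mem_singleton, not_or] at hz hw
  have hnone : ∀ u, ¬ (G.Adj x u ∧ G.Adj z u) := by
    rintro u ⟨hu, hu'⟩
    obtain ⟨t, ht⟩ : ∃ t, t ∉ {x, z} ∪ (G.neighborFinset x ∪ G.neighborFinset z) := by
      by_contra! hall
      have h1 := Finset.card_le_card (fun t _ => hall t : Finset.univ ⊆ _)
      have h2 := Finset.card_union_le {x, z} (G.neighborFinset x ∪ G.neighborFinset z)
      have h3 := Finset.card_union_le (G.neighborFinset x) (G.neighborFinset z)
      have h4 : ({x, z} : Finset V).card ≤ 2 := Finset.card_le_two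
      rw [SimpleGraph.card_neighborFinset_eq_degree,
        SimpleGraph.card_neighborFinset_eq_degree] at h3
      have := hdeg x
      have := hdeg z
      rw [Finset.card_univ] at h1
      omega
    simp only [Finset.mem_union, Finset.mem_insert, Finset.mem_singleton,
      SimpleGraph.mem_neighborFinset, not_or] at ht
    exact not_exists_common_of_not_hasBalancedCycle hG (Ne.symm hz.1) hu hu'
      ⟨Ne.symm ht.1.1, ht.2.1⟩ ⟨Ne.symm ht.1.2, ht.2.2⟩
  have h1 : ¬ G.Adj z y := fun h => hnone y ⟨hxy, h⟩
  have h2 : ¬ G.Adj x w := fun h => hnone w ⟨h, hzw⟩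
  refine hG (hasBalancedCycle_one (a := x) (x := y) (b := z) (y := w) ?_ ?_)
  · simp [hxy.ne, hzw.ne, Ne.symm hz.1, Ne.symm hz.2, Ne.symm hw.1, Ne.symm hw.2]
  · simp [adjInd, hxy, hzw, h1, h2]

open scoped Classical in
/-- The case of 4-cycles: without a balanced one, any two vertices have almost the same
neighbourhoods, so that `G` or its complement has maximum degree at most two. -/
lemma hasBalancedCycle_one_or_compl (G : SimpleGraph V) (hV : 10 ≤ Fintype.card V)
    (hE : 5 ≤ G.edgeSet.ncard) (hE' : 5 ≤ Gᶜ.edgeSet.ncard) :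
    HasBalancedCycle G 1 ∨ HasBalancedCycle Gᶜ 1 := by
  by_contra! hG
  by_cases h1 : ∀ x, G.degree x ≤ 2
  · exact hG.1 (hasBalancedCycle_one_of_degree_le_two hV h1 (by rwa [card_edgeFinset_eq_ncard]))
  by_cases h2 : ∀ x, Gᶜ.degree x ≤ 2
  · refine hG.2 (hasBalancedCycle_one_of_degree_le_two hV (fun x => ?_)
      (by rwa [card_edgeFinset_eq_ncard]))
    convert h2 x
  push Not at h1 h2
  obtain ⟨a, ha⟩ := h1
  obtain ⟨b, hb⟩ := h2
  obtain ⟨c, hc⟩ : ∃ c, c ≠ a := by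
    have : Nontrivial V := Fintype.one_lt_card_iff_nontrivial.1 (by omega)
    exact exists_ne a
  -- the common neighbour and non-neighbour are taken for `a`, `b`, or for `a`, `c` if `a = b`
  by_cases hab : a = b
  · subst hab
    obtain ⟨x, hx, hx'⟩ := exists_common_neighbor hG.1 hc.symm ha
    obtain ⟨y, hy, hy'⟩ := exists_common_neighbor hG.2 hc.symm (by convert Nat.succ_le_of_lt hb)
    exact not_exists_common_of_not_hasBalancedCycle hG.1 hc.symm hx hx' hy hy'
  · obtain ⟨x, hx, hx'⟩ := exists_common_neighbor hG.1 hab ha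
    obtain ⟨y, hy, hy'⟩ := exists_common_neighbor hG.2 (Ne.symm hab)
      (by convert Nat.succ_le_of_lt hb)
    exact not_exists_common_of_not_hasBalancedCycle hG.1 hab hx hx' hy' hy

end Four

/-! ### Copies of cycle graphs -/

section Copies

open SimpleGraph

variable {V : Type*}

lemma edgeSet_toSubgraph_cycleGraph {N : ℕ} {H : SimpleGraph V}
    (φ : (cycleGraph (N + 3)).Copy H) :
    φ.toSubgraph.edgeSet = Set.range fun i : Fin (N + 3) => s(φ i, φ (i + 1)) := by
  ext e
  induction e with
  | _ x y =>
  simp only [Copy.toSubgraph, Subgraph.edgeSet_map, Subgraph.edgeSet_top, Set.mem_image,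
    Set.mem_range]
  constructor
  · rintro ⟨e, he, hxy⟩
    induction e with
    | _ i j =>
    rw [mem_edgeSet, cycleGraph_adj] at he
    rcases he with he | he
    · refine ⟨j, ?_⟩
      rw [← hxy, ← he, add_sub_cancel, Sym2.eq_swap]
      rfl
    · refine ⟨i, ?_⟩
      rw [← hxy, ← he, add_sub_cancel]
      rfl
  · rintro ⟨i, hi⟩
    refine ⟨s(i, i + 1), ?_, hi⟩
    rw [mem_edgeSet, cycleGraph_adj]
    right
    simp

lemma injective_cycle_edges {N : ℕ} {u : Fin (N + 3) → V} (hu : Function.Injective u) :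
    Function.Injective fun i : Fin (N + 3) => s(u i, u (i + 1)) := by
  intro i j hij
  simp only [Sym2.eq_iff] at hij
  rcases hij with h | h
  · exact hu h.1
  · have h1 := hu h.1
    have h2 := hu h.2
    rw [h1, add_assoc] at h2
    have h3 : (1 + 1 : Fin (N + 3)) = 0 := by simpa using h2
    simp only [Fin.ext_iff, Fin.val_add, Fin.val_one, Fin.val_zero] at h3
    rw [Nat.mod_eq_of_lt (by omega)] at h3
    omega

lemma chainCount_ofFn (G : SimpleGraph V) {m : ℕ} (u : Fin (m + 1) → V) :
    chainCount G (List.ofFn u) = ∑ i : Fin m, adjInd G (u i.castSucc) (u i.succ) := by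
  induction m with
  | zero => simp
  | succ m ih =>
    have := ih fun i => u i.succ
    rw [List.ofFn_succ] at this
    rw [List.ofFn_succ, List.ofFn_succ, chainCount_cons_cons, this, Fin.sum_univ_succ]
    rfl

lemma cycleCount_ofFn (G : SimpleGraph V) {m : ℕ} (u : Fin (m + 1) → V) :
    cycleCount G (List.ofFn u) = ∑ i : Fin (m + 1), adjInd G (u i) (u (i + 1)) := by
  have h1 : cycleCount G (List.ofFn u) = chainCount G (List.ofFn u ++ [u 0]) := by
    rw [List.ofFn_succ]; rfl
  have h2 : List.ofFn u = (List.ofFn fun i : Fin m => u i.castSucc) ++ [u (Fin.last m)] := by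
    rw [List.ofFn_succ', List.concat_eq_append]
  rw [h1, h2, List.append_assoc, List.singleton_append, chainCount_append_pair, ← h2,
    chainCount_ofFn, Fin.sum_univ_castSucc]
  simp

open scoped Classical in
lemma hasBalancedCopy_of_cycleCount {n N : ℕ} (G : SimpleGraph (Fin n)) {l : List (Fin n)}
    (hl : l.Nodup) (hlen : l.length = N + 3) (hc : 2 * cycleCount G l = N + 3) :
    HasBalancedCopy (cycleGraph (N + 3)) G.edgeSet Gᶜ.edgeSet := by
  obtain ⟨u, rfl⟩ : ∃ u : Fin (N + 3) → Fin n, l = List.ofFn u := by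
    refine ⟨fun i => l.get (i.cast hlen.symm), ?_⟩
    refine List.ext_get (by simp [hlen]) fun i h1 h2 => by
      simp [-List.ofFn_succ]
  rw [List.nodup_ofFn] at hl
  let φ : (cycleGraph (N + 3)).Copy (⊤ : SimpleGraph (Fin n)) :=
    ⟨⟨u, fun h => hl.ne h.ne⟩, hl⟩
  have hinj := injective_cycle_edges hl
  set e : Fin (N + 3) → Sym2 (Fin n) := fun i => s(u i, u (i + 1)) with he
  set I : Finset (Fin (N + 3)) := Finset.univ.filter fun i => G.Adj (u i) (u (i + 1)) with hI
  have hIc : I.card = cycleCount G (List.ofFn u) := by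
    rw [cycleCount_ofFn, hI, Finset.card_filter]
    rfl
  refine ⟨φ, e '' I, e '' (Iᶜ : Finset _), ?_, ?_, ?_, ?_, ?_⟩
  · rw [← Set.image_union, edgeSet_toSubgraph_cycleGraph, Finset.coe_compl, Set.union_compl_self,
      Set.image_univ]
    rfl
  · rw [Set.disjoint_image_iff hinj, Finset.coe_compl]
    exact disjoint_compl_right
  · rintro _ ⟨i, hi, rfl⟩
    rw [mem_edgeSet]
    simpa [hI] using hi
  · rintro _ ⟨i, hi, rfl⟩
    have hne : i ≠ i + 1 := by simp
    simp only [hI, Finset.coe_compl, Set.mem_compl_iff, Finset.mem_coe, Finset.mem_filter,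
      Finset.mem_univ, true_and] at hi
    simp [he, hi, hl.eq_iff]
  · rw [Set.ncard_image_of_injective _ hinj, Set.ncard_image_of_injective _ hinj,
      Set.ncard_coe_finset, Set.ncard_coe_finset, Finset.card_compl, Fintype.card_fin, hIc]
    have : N + 3 - cycleCount G (List.ofFn u) = cycleCount G (List.ofFn u) := by omega
    rw [this]
    simp

lemma HasBalancedCycle.hasBalancedCopy {n k : ℕ} (hk : 1 ≤ k) {G : SimpleGraph (Fin n)}
    (h : HasBalancedCycle G k) :
    HasBalancedCopy (cycleGraph (4 * k)) G.edgeSet Gᶜ.edgeSet := by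
  obtain ⟨l, h1, h2, h3⟩ := h
  obtain ⟨N, hN⟩ : ∃ N, 4 * k = N + 3 := ⟨4 * k - 3, by omega⟩
  rw [hN]
  exact hasBalancedCopy_of_cycleCount G h1 (by omega) (by omega)

lemma HasBalancedCopy.symm {W : Type*} {H : SimpleGraph W} {n : ℕ} {R B : Set (Sym2 (Fin n))}
    (h : HasBalancedCopy H R B) : HasBalancedCopy H B R := by
  obtain ⟨φ, E₁, E₂, h1, h2, h3, h4, h5⟩ := h
  exact ⟨φ, E₂, E₁, by rw [Set.union_comm, h1], h2.symm, h4, h3, by rwa [abs_sub_comm]⟩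

lemma HasBalancedCopy.mono {W : Type*} {H : SimpleGraph W} {n : ℕ}
    {R B R' B' : Set (Sym2 (Fin n))} (h : HasBalancedCopy H R B) (hR : R ⊆ R') (hB : B ⊆ B') :
    HasBalancedCopy H R' B' := by
  obtain ⟨φ, E₁, E₂, h1, h2, h3, h4, h5⟩ := h
  exact ⟨φ, E₁, E₂, h1, h2, h3.trans hR, h4.trans hB, h5⟩

open scoped Classical in
/-- If every edge of one color meets a set of fewer than `k` vertices, then a cycle has fewer than
`2 * k` edges of that color. -/
lemma not_hasBalancedCopy_of_cover {n k : ℕ} {R B : Set (Sym2 (Fin n))}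
    (A : Finset (Fin n)) (hA : A.card < k) (hR : ∀ e ∈ R, ∃ x ∈ A, x ∈ e) :
    ¬ HasBalancedCopy (cycleGraph (4 * k)) R B := by
  obtain ⟨N, hN⟩ : ∃ N, 4 * k = N + 3 := ⟨4 * k - 3, by omega⟩
  rw [hN]
  rintro ⟨φ, E₁, E₂, h1, h2, h3, -, h5⟩
  have hφ : Function.Injective φ := φ.injective
  rw [edgeSet_toSubgraph_cycleGraph] at h1
  have hinj := injective_cycle_edges hφ
  have hcard : E₁.ncard + E₂.ncard = N + 3 := by
    rw [← Set.ncard_union_eq h2 (Set.toFinite _) (Set.toFinite _), h1, ← Set.image_univ,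
      Set.ncard_image_of_injective _ hinj, Set.ncard_univ, Nat.card_fin]
  set e : Fin (N + 3) → Sym2 (Fin n) := fun i => s(φ i, φ (i + 1)) with he
  set I : Finset (Fin (N + 3)) := Finset.univ.filter fun i => φ i ∈ A with hI
  set J : Finset (Fin (N + 3)) := Finset.univ.filter fun i => φ (i + 1) ∈ A with hJ
  have hIA : I.card ≤ A.card :=
    Finset.card_le_card_of_injOn φ (fun i hi => by simpa [hI] using hi) hφ.injOn
  have hJA : J.card ≤ A.card :=
    Finset.card_le_card_of_injOn (fun i => φ (i + 1)) (fun i hi => by simpa [hJ] using hi)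
      (fun i _ j _ h => add_right_cancel (hφ h))
  have hsub : E₁ ⊆ ((I ∪ J).image e : Finset _) := by
    intro d hd
    obtain ⟨i, rfl⟩ : d ∈ Set.range e := h1 ▸ Or.inl hd
    obtain ⟨x, hx, hxe⟩ := hR _ (h3 hd)
    rw [Finset.coe_image]
    refine Set.mem_image_of_mem e ?_
    rcases Sym2.mem_iff.1 hxe with rfl | rfl
    · simp [hI, hx]
    · simp [hJ, hx]
  have hle := (Set.ncard_le_ncard hsub (Set.toFinite _)).trans_eq (Set.ncard_coe_finset _)
  have := (Finset.card_image_le (s := I ∪ J) (f := e)).trans (Finset.card_union_le I J)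
  rw [abs_le] at h5
  omega

end Copies

/-! ### Colorings, list colorings and the threshold -/

section Colorings

open SimpleGraph

variable {n : ℕ}

open scoped Classical in
/-- The 2-coloring of the complete graph whose red edges are those in `R`. -/
noncomputable def coloringOfRed (R : Set (Sym2 (Fin n))) : TwoColoring n :=
  fun e => if e.1 ∈ R then .red else .blue

lemma colorClass_red_coloringOfRed (R : Set (Sym2 (Fin n))) :
    (coloringOfRed R).colorClass .red = KEdges n ∩ R := by
  ext e
  by_cases h : e ∈ R <;> simp [TwoColoring.colorClass, coloringOfRed, h]

lemma colorClass_blue_coloringOfRed (R : Set (Sym2 (Fin n))) :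
    (coloringOfRed R).colorClass .blue = KEdges n \ R := by
  ext e
  by_cases h : e ∈ R <;> simp [TwoColoring.colorClass, coloringOfRed, h]

lemma edgeSet_compl_eq (G : SimpleGraph (Fin n)) : Gᶜ.edgeSet = KEdges n \ G.edgeSet := by
  ext e
  induction e with
  | _ x y => simp [KEdges]

lemma exists_edgeSet_eq_colorClass (f : TwoColoring n) : ∃ G : SimpleGraph (Fin n),
    f.colorClass .red = G.edgeSet ∧ f.colorClass .blue = Gᶜ.edgeSet := by
  have hred : f.colorClass .red = (fromEdgeSet (f.colorClass .red)).edgeSet := by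
    rw [edgeSet_fromEdgeSet]
    ext e
    refine ⟨fun h => ⟨h, fun hd => ?_⟩, fun h => h.1⟩
    obtain ⟨he, -⟩ := h
    exact not_isDiag_of_mem_edgeSet _ he hd
  refine ⟨fromEdgeSet (f.colorClass .red), hred, ?_⟩
  rw [edgeSet_compl_eq, ← hred]
  ext e
  simp only [TwoColoring.colorClass, Set.mem_ofPred_eq, Set.mem_sdiff]
  constructor
  · rintro ⟨h, hb⟩
    exact ⟨h, fun ⟨_, hr⟩ => by rw [hb] at hr; cases hr⟩
  · rintro ⟨h, hr⟩
    refine ⟨h, ?_⟩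
    cases hf : f ⟨e, h⟩ with
    | red => exact (hr ⟨h, hf⟩).elim
    | blue => rfl

lemma two_mul_ncard_KEdges (n : ℕ) : 2 * (KEdges n).ncard = n * (n - 1) := by
  have := two_mul_ncard_edgeSet_add_compl (⊤ : SimpleGraph (Fin n))
  simpa using this

lemma ncard_colorClass_add (f : TwoColoring n) :
    (f.colorClass .red).ncard + (f.colorClass .blue).ncard = (KEdges n).ncard := by
  obtain ⟨G, h1, h2⟩ := exists_edgeSet_eq_colorClass f
  have h3 := two_mul_ncard_edgeSet_add_compl G
  rw [Fintype.card_fin, ← two_mul_ncard_KEdges] at h3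
  rw [h1, h2]
  omega

lemma exists_coloring_exceeds {m : ℕ} (h : 2 * m ≤ (KEdges n).ncard) :
    ∃ f : TwoColoring n, f.Exceeds ((m : ℤ) - 1) := by
  obtain ⟨R, hR, hm⟩ := Set.exists_subset_card_eq (s := KEdges n) (n := m) (by omega)
  have h1 := ncard_colorClass_add (coloringOfRed R)
  have h2 : ((coloringOfRed R).colorClass .red).ncard = m := by
    rw [colorClass_red_coloringOfRed, Set.inter_eq_right.2 hR, hm]
  exact ⟨coloringOfRed R, by unfold TwoColoring.Exceeds; omega⟩

/-- Every list coloring with large color classes can be thinned out to a coloring with large color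
classes, as soon as colorings with such classes exist: the edges with two colors are shared out so
that the number of red ones falls into the required interval. -/
lemma exists_coloring_le_listColoring (L : TwoListColoring n) {m : ℤ} (hL : L.Exceeds m)
    (hm : ∃ f : TwoColoring n, f.Exceeds m) :
    ∃ f : TwoColoring n, f.Exceeds m ∧ f.colorClass .red ⊆ L.colorClass .red ∧
      f.colorClass .blue ⊆ L.colorClass .blue := by
  classical
  obtain ⟨f, hf1, hf2⟩ := hm
  obtain ⟨hL1, hL2⟩ := hL
  have hf := ncard_colorClass_add f
  set R := L.colorClass .red
  set B := L.colorClass .blue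
  have hRK : R ⊆ KEdges n := fun e he => he.1
  have hBK : B ⊆ KEdges n := fun e he => he.1
  have hKB : KEdges n \ B ⊆ R := by
    rintro e ⟨he, hB⟩
    obtain ⟨c, hc⟩ := L.list_nonempty ⟨e, he⟩
    cases c with
    | red => exact ⟨he, hc⟩
    | blue => exact (hB ⟨he, hc⟩).elim
  have h1 := Set.ncard_sdiff_add_ncard_of_subset hBK
  have h2 := Set.ncard_le_ncard hKB
  have h3 := Set.ncard_le_ncard hBK
  have h4 := Set.ncard_le_ncard hRK
  obtain ⟨R', hR1, hR2, hR3⟩ := Set.exists_subsuperset_card_eq hKB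
    (n := max (KEdges n \ B).ncard (m + 1).toNat) (le_max_left _ _) (by omega)
  have hred : (coloringOfRed R').colorClass .red = R' := by
    rw [colorClass_red_coloringOfRed, Set.inter_eq_right.2 (hR2.trans hRK)]
  have h5 := ncard_colorClass_add (coloringOfRed R')
  refine ⟨coloringOfRed R', ?_, by rw [hred]; exact hR2, ?_⟩
  · rw [hred] at h5
    unfold TwoColoring.Exceeds
    rw [hred]
    omega
  · rw [colorClass_blue_coloringOfRed]
    rintro e ⟨he, heR⟩
    by_contra hB
    exact heR (hR1 ⟨he, hB⟩)

/-- A coloring, viewed as a list coloring with lists of length one. -/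
def TwoColoring.toList (f : TwoColoring n) : TwoListColoring n where
  list e := {f e}
  list_nonempty _ := Set.singleton_nonempty _

lemma TwoColoring.colorClass_toList (f : TwoColoring n) (c : Color) :
    f.toList.colorClass c = f.colorClass c := by
  ext e
  simp [TwoListColoring.colorClass, TwoColoring.colorClass, TwoColoring.toList, eq_comm]

/-- Below the threshold `(k - 1) * (n - (k - 1))`, the coloring with all edges at `k - 1` vertices
red has no balanced cycle. -/
lemma exists_coloring_not_hasBalancedCopy {k : ℕ} (hk : 1 ≤ k) (hn : 4 * k ≤ n) {m : ℤ}
    (hm : m < ((k : ℤ) - 1) * n - ((k : ℤ) - 1) ^ 2) :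
    ∃ f : TwoColoring n, f.Exceeds m ∧
      ¬ HasBalancedCopy (cycleGraph (4 * k)) (f.colorClass .red) (f.colorClass .blue) := by
  classical
  obtain ⟨A, -, hA⟩ := Finset.exists_subset_card_eq (s := (Finset.univ : Finset (Fin n)))
    (n := k - 1) (by simp; omega)
  let R : Set (Sym2 (Fin n)) := {e | e ∈ KEdges n ∧ ∃ x ∈ A, x ∈ e}
  let G : SimpleGraph (Fin n) := fromEdgeSet R
  have hred : (coloringOfRed R).colorClass .red = R := by
    rw [colorClass_red_coloringOfRed, Set.inter_eq_right]
    exact fun e he => he.1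
  have hlow : (k - 1) * (n - (k - 1)) ≤ R.ncard := by
    have hc : (A ×ˢ Aᶜ).card = (k - 1) * (n - (k - 1)) := by
      rw [Finset.card_product, Finset.card_compl, hA, Fintype.card_fin]
    rw [← hc, ← Set.ncard_coe_finset]
    refine Set.ncard_le_ncard_of_injOn (fun p => s(p.1, p.2)) ?_ ?_
    · rintro ⟨x, y⟩ hp
      simp only [Finset.mem_coe, Finset.mem_product, Finset.mem_compl] at hp
      have hxy : x ≠ y := fun h => hp.2 (h ▸ hp.1)
      exact ⟨by simpa [KEdges] using hxy, x, hp.1, by simp⟩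
    · rintro ⟨x, y⟩ hp ⟨x', y'⟩ hp' h
      simp only [Finset.mem_coe, Finset.mem_product, Finset.mem_compl] at hp hp'
      rcases Sym2.eq_iff.1 h with ⟨h1, h2⟩ | ⟨h1, h2⟩
      · exact Prod.ext h1 h2
      · change x = y' at h1
        exact (hp'.2 (h1 ▸ hp.1)).elim
  have hup : R.ncard ≤ (k - 1) * (n - 1) := by
    have hGR : G.edgeSet = R := by
      rw [edgeSet_fromEdgeSet]
      ext e
      refine ⟨fun h => h.1, fun h => ⟨h, fun hd => ?_⟩⟩
      exact not_isDiag_of_mem_edgeSet _ h.1 hd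
    have := card_edgeFinset_le_of_cover G A fun x y hxy => by
      rw [← mem_edgeSet, hGR] at hxy
      obtain ⟨-, z, hz, hzxy⟩ := hxy
      rcases Sym2.mem_iff.1 hzxy with rfl | rfl
      · exact Or.inl hz
      · exact Or.inr hz
    rwa [card_edgeFinset_eq_ncard, hGR, hA, Fintype.card_fin] at this
  have htot := ncard_colorClass_add (coloringOfRed R)
  have hK := two_mul_ncard_KEdges n
  have hsmall : 4 * ((k - 1) * (n - 1)) ≤ n * (n - 1) := by
    rw [← mul_assoc]; gcongr; omega
  rw [hred] at htot
  have hm' : m < (R.ncard : ℤ) := by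
    refine hm.trans_le ?_
    have h1 : (((k - 1) * (n - (k - 1)) : ℕ) : ℤ) = ((k : ℤ) - 1) * (n - ((k : ℤ) - 1)) := by
      push_cast [Nat.cast_sub (show k - 1 ≤ n by omega), Nat.cast_sub hk]
      ring
    have h2 : (((k - 1) * (n - (k - 1)) : ℕ) : ℤ) ≤ R.ncard := by exact_mod_cast hlow
    rw [h1] at h2
    linarith [mul_sub ((k : ℤ) - 1) n ((k : ℤ) - 1), sq ((k : ℤ) - 1)]
  refine ⟨coloringOfRed R, ⟨by rwa [hred], by omega⟩, ?_⟩
  rw [hred]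
  exact not_hasBalancedCopy_of_cover A (by omega) fun e he => he.2

/-- Every coloring with sufficiently large color classes has a balanced cycle. -/
lemma hasBalancedCopy_of_exceeds {k : ℕ} (hk : 1 ≤ k)
    (hn : 144 * k ^ 2 + 104 * k + 49 ≤ 32 * n) (f : TwoColoring n)
    (hf : f.Exceeds ((((k - 1) * n + 12 * k ^ 2 + 3 * k : ℕ) : ℤ) - 1)) :
    HasBalancedCopy (cycleGraph (4 * k)) (f.colorClass .red) (f.colorClass .blue) := by
  obtain ⟨G, h1, h2⟩ := exists_edgeSet_eq_colorClass f
  obtain ⟨hr, hb⟩ := hf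
  rw [h1] at hr
  rw [h2] at hb
  rw [h1, h2]
  have hG : HasBalancedCycle G k ∨ HasBalancedCycle Gᶜ k := by
    rcases hk.eq_or_lt with rfl | hk2
    · exact hasBalancedCycle_one_or_compl G (by rw [Fintype.card_fin]; omega) (by omega) (by omega)
    · have h3 : 16 * k ≤ n + 5 ∧ 10 * k + 7 ≤ n := by
        rcases (Nat.succ_le_of_lt hk2).eq_or_lt with rfl | hk3
        · norm_num at hn
          omega
        · have : 3 * k ≤ k ^ 2 := by rw [sq]; gcongr; exact hk3
          omega
      have hcard : Fintype.card (Fin n) = n := Fintype.card_fin n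
      rcases le_total G.edgeSet.ncard Gᶜ.edgeSet.ncard with hle | hle
      · exact hasBalancedCycle_or_compl G hk2 (by omega) (by omega) (by rw [hcard]; omega) hle
      · have := hasBalancedCycle_or_compl Gᶜ hk2 (by omega) (by omega) (by rw [hcard]; omega)
          (by rwa [compl_compl])
        rw [compl_compl] at this
        exact this.symm
  rcases hG with h | h
  · exact h.hasBalancedCopy hk
  · have := (h.hasBalancedCopy hk).symm
    rwa [compl_compl] at this

lemma four_mul_threshold_le {k : ℕ} (hk : 1 ≤ k)
    (hn : 144 * k ^ 2 + 104 * k + 49 ≤ 32 * n) :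
    4 * ((k - 1) * n + 12 * k ^ 2 + 3 * k) ≤ n * (n - 1) := by
  obtain ⟨j, rfl⟩ : ∃ j, k = j + 1 := ⟨k - 1, by omega⟩
  obtain ⟨i, rfl⟩ : ∃ i, n = i + 1 := ⟨n - 1, by omega⟩
  simp only [Nat.add_sub_cancel]
  rcases Nat.eq_zero_or_pos j with rfl | hj
  · nlinarith
  · have : 12 * j + 9 ≤ i := by nlinarith
    nlinarith

end Colorings

end Balancing

theorem mainTheorem3 (k n : ℕ) (hk : 1 ≤ k)
    (hn : (9 / 2 : ℝ) * (k : ℝ) ^ 2 + (13 / 4 : ℝ) * (k : ℝ) + 49 / 32 ≤ (n : ℝ)) :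
    ∃ bal lbal : ℤ,
      Balancing.IsBalancingNumber n (SimpleGraph.cycleGraph (4 * k)) bal ∧
      Balancing.IsListBalancingNumber n (SimpleGraph.cycleGraph (4 * k)) lbal ∧
      ((k : ℤ) - 1) * (n : ℤ) - ((k : ℤ) - 1) ^ 2 ≤ lbal ∧
      lbal = bal ∧
      bal < ((k : ℤ) - 1) * (n : ℤ) + 12 * (k : ℤ) ^ 2 + 3 * (k : ℤ) := by
  have hn' : 144 * k ^ 2 + 104 * k + 49 ≤ 32 * n := by
    have : (144 * k ^ 2 + 104 * k + 49 : ℝ) ≤ 32 * n := by linarith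
    exact_mod_cast this
  have h4k : 4 * k ≤ n := by nlinarith
  set M : ℕ := (k - 1) * n + 12 * k ^ 2 + 3 * k with hM
  have hMcast : (M : ℤ) = ((k : ℤ) - 1) * n + 12 * k ^ 2 + 3 * k := by
    rw [hM]; push_cast [Nat.cast_sub hk]; ring
  let P : ℤ → Prop := fun m => (∃ f : Balancing.TwoColoring n, f.Exceeds m) ∧
    ∀ f : Balancing.TwoColoring n, f.Exceeds m →
      Balancing.HasBalancedCopy (SimpleGraph.cycleGraph (4 * k))
        (f.colorClass .red) (f.colorClass .blue)
  have hlow : ∀ m, P m → ((k : ℤ) - 1) * (n : ℤ) - ((k : ℤ) - 1) ^ 2 ≤ m := by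
    intro m hm
    by_contra! hlt
    obtain ⟨f, hf1, hf2⟩ := Balancing.exists_coloring_not_hasBalancedCopy hk h4k hlt
    exact hf2 (hm.2 f hf1)
  have hPM : P ((M : ℤ) - 1) :=
    ⟨Balancing.exists_coloring_exceeds (by
      have h1 := Balancing.four_mul_threshold_le hk hn'
      have h2 := Balancing.two_mul_ncard_KEdges n
      omega), Balancing.hasBalancedCopy_of_exceeds hk hn'⟩
  obtain ⟨b, hb, hmin⟩ := Int.exists_least_of_bdd ⟨_, hlow⟩ ⟨_, hPM⟩
  refine ⟨b, b, ⟨hb, fun m hm => hmin m hm⟩, ⟨?_, ?_⟩, hlow b hb, rfl, ?_⟩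
  · intro L hL
    obtain ⟨f, hf, hr, hbl⟩ := Balancing.exists_coloring_le_listColoring L hL hb.1
    exact (hb.2 f hf).mono hr hbl
  · intro m hm
    by_contra! hlt
    -- below `b`, colorings exceeding the bound exist, and they are list colorings
    refine hlt.not_ge (hmin m ⟨?_, fun f hf => ?_⟩)
    · obtain ⟨f, hf1, hf2⟩ := hb.1
      exact ⟨f, hlt.trans hf1, hlt.trans hf2⟩
    · have := hm f.toList (by
        unfold Balancing.TwoListColoring.Exceeds
        rw [f.colorClass_toList, f.colorClass_toList]
        exact hf)
      rwa [f.colorClass_toList, f.colorClass_toList] at this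
  · have := hmin _ hPM
    omega
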